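/- Let $0\le p\le 1$, $0\le r<1/2$, and fix a transmit power $P>0$ and a noise variance $\sigma^2>0$. Let $M=N^2$ with $N\in\mathbb{N}$, $N\ge 1$, and consider a satellite at altitude $H=H_M>0$ with a uniform planar array of $M_x\times M_y$ elements, $M_x=M_y=\sqrt M=N$. It serves $K=K_M$ users, where $K_M$ is $M^p$ rounded to an integer (any integer with $|K_M-M^p|<1$). The user locations $(x_k,y_k)$, $1\le k\le K$, are i.i.d. uniform on the square $[-R,R]\times[-R,R]$, where $R=R_M$ satisfies $R/H=M^{-r}$. Put $$\mathbf a(x;n)=\tfrac1{\sqrt n}\,[1,e^{j2\pi x},\dots,e^{j2\pi(n-1)x}]^{\mathsf T},\qquad \mathbf h_k=\sqrt M\;\mathbf a\!\left(\tfrac{y_k}{2H};M_y\right)\otimes\mathbf a\!\left(\tfrac{x_k}{2H};M_x\right),\qquad \mathbf H=[\mathbf h_1,\dots,\mathbf h_K],$$ and let $\mathbf F=[\mathbf f_1,\dots,\mathbf f_K]=\eta\,\mathbf H(\mathbf H^{\mathsf H}\mathbf H)^{-1}$, $\eta=\big(\mathrm{tr}((\mathbf H^{\mathsf H}\mathbf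 H)^{-1})\big)^{-1/2}$, be the zero-forcing (ZF) precoder ($\mathbf F=0$ if $\mathbf H^{\mathsf H}\mathbf H$ is singular). The ZF sum rate is $$R_\Sigma=\sum_{k=1}^K\log_2\!\left(1+\frac{P\,|\mathbf h_k^{\mathsf H}\mathbf f_k|^2}{P\sum_{i\ne k}|\mathbf h_k^{\mathsf H}\mathbf f_i|^2+\sigma^2}\right),$$ which equals $K\log_2\!\big(1+\tfrac{P}{\sigma^2\,\mathrm{tr}((\mathbf H^{\mathsf H}\mathbf H)^{-1})}\big)$ when $\mathbf H^{\mathsf H}\mathbf H$ is invertible. Then $R_\Sigma$ is integrable for every such $M$, and its expectation over the user locations satisfies, as $M\to\infty$ along the perfect squares: (i) if $p+2r-1\le 0$, then $\mathbb E[R_\Sigma]=O(M^p\log M)$; (ii) if $p+2r-1>0$, then $\mathbb E[R_\Sigma]\to 0$. -/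

import Mathlib

open MeasureTheory ProbabilityTheory Filter Topology Asymptotics
open scoped Matrix

noncomputable section

namespace SatelliteUPA

/-- Response vector `a(x; M) = M^{-1/2} [1, e^{j2πx}, …, e^{j2π(M-1)x}]ᵀ`. -/
def responseVector (M : ℕ) (x : ℝ) : Fin M → ℂ := fun m =>
  ((1 / √(M : ℝ) : ℝ) : ℂ) * Complex.exp (Complex.I * ((2 * Real.pi * (m : ℝ) * x : ℝ) : ℂ))

/-- Steering vector `a(u_y; M_y) ⊗ a(u_x; M_x)` of the planar array; the `M_x M_y` antenna
elements are indexed by pairs. -/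
def steeringVector (Mx My : ℕ) (ux uy : ℝ) : Fin My × Fin Mx → ℂ := fun i =>
  responseVector My uy i.1 * responseVector Mx ux i.2

/-- Line-of-sight channel matrix with unit gains: column `k` is `√M a_k`, `M = M_x M_y`, for a user
at `(x_k, y_k)` seen from altitude `H`, with the small-angle spatial frequencies
`u_x = x_k / (2H)`, `u_y = y_k / (2H)`. -/
def channelMatrix (Mx My : ℕ) (H : ℝ) {K : ℕ} (pos : Fin K → ℝ × ℝ) :
    Matrix (Fin My × Fin Mx) (Fin K) ℂ :=
  Matrix.of fun i k =>
    ((√((Mx : ℝ) * (My : ℝ)) : ℝ) : ℂ) *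
      steeringVector Mx My ((pos k).1 / (2 * H)) ((pos k).2 / (2 * H)) i

section ZeroForcing

variable {ι : Type*} [Fintype ι] {K : ℕ}

open Classical in
/-- Zero-forcing precoder `F = η H (Hᴴ H)⁻¹`, `η = (tr (Hᴴ H)⁻¹)^{-1/2}`. If `Hᴴ H` is singular, no
zero-forcing precoder exists and nothing is transmitted. -/
def zfPrecoder (H : Matrix ι (Fin K) ℂ) : Matrix ι (Fin K) ℂ :=
  if IsUnit (Hᴴ * H).det then
    ((√(1 / ((Hᴴ * H)⁻¹.trace).re) : ℝ) : ℂ) • (H * (Hᴴ * H)⁻¹)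
  else 0

/-- SINR of user `k` for `y = √P Hᴴ F s + z`, with unit-power independent symbols and noise
variance `σ2`. -/
def sinr (P σ2 : ℝ) (H F : Matrix ι (Fin K) ℂ) (k : Fin K) : ℝ :=
  P * ‖(Hᴴ * F) k k‖ ^ 2 / (P * ∑ i ∈ Finset.univ.erase k, ‖(Hᴴ * F) k i‖ ^ 2 + σ2)

/-- Sum rate under zero-forcing precoding, in bits per channel use. -/
def zfSumRate (P σ2 : ℝ) (H : Matrix ι (Fin K) ℂ) : ℝ :=
  ∑ k, Real.logb 2 (1 + sinr P σ2 H (zfPrecoder H) k)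

end ZeroForcing

/-- Law of the locations of `K` users, i.i.d. uniform on the square `[-R, R] × [-R, R]`. -/
def userLaw (R : ℝ) (K : ℕ) : Measure (Fin K → ℝ × ℝ) :=
  Measure.pi fun _ => cond volume (Set.Icc (-R) R ×ˢ Set.Icc (-R) R)

/-- Zero-forcing sum rate of the planar array as a function of the user locations. -/
def upaSumRate (Mx My : ℕ) (P σ2 H : ℝ) {K : ℕ} (pos : Fin K → ℝ × ℝ) : ℝ :=
  zfSumRate P σ2 (channelMatrix Mx My H pos)

end SatelliteUPA

end

/-! Zero forcing removes all interference and gives every user the same received power, the gain `1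
/ tr (Hᴴ H)⁻¹`. This is at most the Rayleigh quotient of `Hᴴ H` at any nonzero vector
(`zfGain_mul_sum_le`), so each test vector yields an upper bound on the rate.

A basis vector bounds the gain by `N ^ 2 = M`, hence the rate by `K log₂ (1 + P M / σ²)`, which is
(i).

For (ii), an entry of `H` is a product of two exponentials with phases at most `π N R / H = π N ^ (1
- 2 r)`. Choose `1 - 2 r < q < p` and truncate both Taylor series at `L = ⌊N ^ q⌋`. Only `L ^ 2 < K`
monomials remain, so some `c ≠ 0` annihilates them all and `H c` is of order `exp (-L)`. The gain is
then at most `64 N² K exp (-2 L)` (`zfGain_channelMatrix_le`), which beats every power of `N`. The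
bound holds for all positions in the square; independence plays no role. -/

namespace SatelliteUPA

/-! ### Zero forcing for a general channel matrix. -/

section ZeroForcing

variable {ι : Type*} [Fintype ι] {K : ℕ}

/-- Squared amplitude of the zero-forcing precoder: the useful power received by each user. -/
noncomputable def zfGain (H : Matrix ι (Fin K) ℂ) : ℝ :=
  √(1 / ((Hᴴ * H)⁻¹.trace).re) ^ 2

lemma zfGain_nonneg (H : Matrix ι (Fin K) ℂ) : 0 ≤ zfGain H := sq_nonneg _

lemma zfGain_mul_trace_le_one (H : Matrix ι (Fin K) ℂ) :
    zfGain H * ((Hᴴ * H)⁻¹.trace).re ≤ 1 := by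
  unfold zfGain
  rcases le_or_gt ((Hᴴ * H)⁻¹.trace).re 0 with h | h
  · exact (mul_nonpos_of_nonneg_of_nonpos (sq_nonneg _) h).trans zero_le_one
  · rw [Real.sq_sqrt (by positivity), one_div, inv_mul_cancel₀ h.ne']

lemma conjTranspose_mul_zfPrecoder {H : Matrix ι (Fin K) ℂ} (h : IsUnit (Hᴴ * H).det) :
    Hᴴ * zfPrecoder H = ((√(1 / ((Hᴴ * H)⁻¹.trace).re) : ℝ) : ℂ) • (1 : Matrix _ _ ℂ) := by
  rw [zfPrecoder, if_pos h, Matrix.mul_smul, ← Matrix.mul_assoc, Matrix.mul_nonsing_inv _ h]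

open Classical in
lemma sinr_zfPrecoder (P σ2 : ℝ) (H : Matrix ι (Fin K) ℂ) (k : Fin K) :
    sinr P σ2 H (zfPrecoder H) k =
      if IsUnit (Hᴴ * H).det then P * zfGain H / σ2 else 0 := by
  split_ifs with h
  · have hsum : ∑ i ∈ Finset.univ.erase k, ‖(Hᴴ * zfPrecoder H) k i‖ ^ 2 = 0 := by
      refine Finset.sum_eq_zero fun i hi => ?_
      rw [conjTranspose_mul_zfPrecoder h]
      simp [Matrix.one_apply_ne (Finset.ne_of_mem_erase hi).symm]
    rw [sinr, hsum, conjTranspose_mul_zfPrecoder h]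
    simp only [Matrix.smul_apply, Matrix.one_apply_eq, smul_eq_mul, mul_one, mul_zero, zero_add,
      Complex.norm_real, Real.norm_eq_abs, sq_abs, zfGain]
  · rw [sinr, zfPrecoder, if_neg h]
    simp

/-- `G⁻¹ Hᴴ` is a left inverse of `H` with squared Frobenius norm `tr G⁻¹`; Cauchy–Schwarz is
applied to each of its rows. -/
lemma sum_norm_sq_le_trace_mul {H : Matrix ι (Fin K) ℂ} (h : IsUnit (Hᴴ * H).det)
    (c : Fin K → ℂ) :
    ∑ k, ‖c k‖ ^ 2 ≤ ((Hᴴ * H)⁻¹.trace).re * ∑ i, ‖(H *ᵥ c) i‖ ^ 2 := by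
  set G := Hᴴ * H with hG
  set A := G⁻¹ * Hᴴ with hA
  have hc : A *ᵥ (H *ᵥ c) = c := by
    rw [Matrix.mulVec_mulVec, hA, Matrix.mul_assoc, ← hG, Matrix.nonsing_inv_mul _ h,
      Matrix.one_mulVec]
  have hAA : A * Aᴴ = G⁻¹ := by
    have hGh : Gᴴ = G := by simp [hG]
    rw [hA, Matrix.conjTranspose_mul, Matrix.conjTranspose_conjTranspose,
      Matrix.conjTranspose_nonsing_inv, hGh, Matrix.mul_assoc, ← Matrix.mul_assoc Hᴴ, ← hG,
      Matrix.mul_nonsing_inv _ h, Matrix.mul_one]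
  have htr : (G⁻¹.trace).re = ∑ k, ∑ i, ‖A k i‖ ^ 2 := by
    rw [← hAA, Matrix.trace, Complex.re_sum]
    refine Finset.sum_congr rfl fun k _ => ?_
    rw [Matrix.diag_apply, Matrix.mul_apply, Complex.re_sum]
    refine Finset.sum_congr rfl fun i _ => ?_
    rw [Matrix.conjTranspose_apply, ← Complex.normSq_eq_norm_sq, ← Complex.ofReal_re
      (Complex.normSq (A k i)), Complex.normSq_eq_conj_mul_self, mul_comm]
    rfl
  rw [htr, Finset.sum_mul]
  refine Finset.sum_le_sum fun k _ => ?_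
  calc ‖c k‖ ^ 2 = ‖∑ i, A k i * (H *ᵥ c) i‖ ^ 2 := by
        conv_lhs => rw [← hc]
        rfl
    _ ≤ (∑ i, ‖A k i‖ * ‖(H *ᵥ c) i‖) ^ 2 := by
        gcongr
        exact (norm_sum_le _ _).trans_eq (by simp)
    _ ≤ _ := Finset.sum_mul_sq_le_sq_mul_sq _ _ _

/-- The zero-forcing gain is at most the Rayleigh quotient of `Hᴴ H` at any vector. -/
lemma zfGain_mul_sum_le {H : Matrix ι (Fin K) ℂ} (h : IsUnit (Hᴴ * H).det) (c : Fin K → ℂ) :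
    zfGain H * ∑ k, ‖c k‖ ^ 2 ≤ ∑ i, ‖(H *ᵥ c) i‖ ^ 2 :=
  calc zfGain H * ∑ k, ‖c k‖ ^ 2
      ≤ zfGain H * (((Hᴴ * H)⁻¹.trace).re * ∑ i, ‖(H *ᵥ c) i‖ ^ 2) :=
        mul_le_mul_of_nonneg_left (sum_norm_sq_le_trace_mul h c) (zfGain_nonneg H)
    _ = (zfGain H * ((Hᴴ * H)⁻¹.trace).re) * ∑ i, ‖(H *ᵥ c) i‖ ^ 2 := by ring
    _ ≤ _ := mul_le_of_le_one_left (by positivity) (zfGain_mul_trace_le_one H)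

lemma zfSumRate_nonneg {P σ2 : ℝ} (hP : 0 ≤ P) (hσ2 : 0 ≤ σ2) (H : Matrix ι (Fin K) ℂ) :
    0 ≤ zfSumRate P σ2 H := by
  refine Finset.sum_nonneg fun k _ => Real.logb_nonneg one_lt_two ?_
  have : 0 ≤ sinr P σ2 H (zfPrecoder H) k := by unfold sinr; positivity
  linarith

lemma zfSumRate_le_of_gain_le {P σ2 B : ℝ} (hP : 0 ≤ P) (hσ2 : 0 < σ2) (hB : 0 ≤ B)
    {H : Matrix ι (Fin K) ℂ} (h : IsUnit (Hᴴ * H).det → zfGain H ≤ B) :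
    zfSumRate P σ2 H ≤ K * Real.logb 2 (1 + P * B / σ2) := by
  classical
  have key : ∀ k, Real.logb 2 (1 + sinr P σ2 H (zfPrecoder H) k) ≤
      Real.logb 2 (1 + P * B / σ2) := by
    intro k
    rw [sinr_zfPrecoder]
    split_ifs with hu
    · have := zfGain_nonneg H
      apply Real.logb_le_logb_of_le one_lt_two (by positivity)
      have := h hu
      gcongr
    · rw [add_zero, Real.logb_one]
      have : 0 ≤ P * B / σ2 := by positivity
      exact Real.logb_nonneg one_lt_two (by linarith)
  calc zfSumRate P σ2 H ≤ ∑ _k : Fin K, Real.logb 2 (1 + P * B / σ2) :=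
        Finset.sum_le_sum fun k _ => key k
    _ = _ := by simp

lemma measurable_zfSumRate {Ω : Type*} [MeasurableSpace Ω] (P σ2 : ℝ)
    {H : Ω → Matrix ι (Fin K) ℂ} (hH : ∀ i k, Measurable fun ω => H ω i k) :
    Measurable fun ω => zfSumRate P σ2 (H ω) := by
  classical
  have hG : ∀ i j, Measurable fun ω => ((H ω)ᴴ * H ω) i j := by
    intro i j
    simp only [Matrix.mul_apply, Matrix.conjTranspose_apply]
    exact Finset.measurable_sum _ fun l _ => (continuous_star.measurable.comp (hH l i)).mul (hH l j)
  have hGm : Measurable fun ω => ((fun i j => ((H ω)ᴴ * H ω) i j) : Fin K → Fin K → ℂ) :=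
    measurable_pi_lambda _ fun i => measurable_pi_lambda _ fun j => hG i j
  have hdet : Measurable fun ω => ((H ω)ᴴ * H ω).det := by
    have : Continuous fun A : Fin K → Fin K → ℂ => (Matrix.of A).det :=
      Continuous.matrix_det continuous_id
    exact this.measurable.comp hGm
  have hadj : ∀ i, Measurable fun ω => ((H ω)ᴴ * H ω).adjugate i i := by
    intro i
    have : Continuous fun A : Fin K → Fin K → ℂ => (Matrix.of A).adjugate i i :=
      (Continuous.matrix_adjugate continuous_id).matrix_elem i i
    exact this.measurable.comp hGm
  -- The inverse is not continuous at singular matrices, but it is the adjugate over the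
  -- determinant, both polynomial in the entries.
  have htr : Measurable fun ω => (((H ω)ᴴ * H ω)⁻¹.trace).re := by
    refine Complex.measurable_re.comp ?_
    simp only [Matrix.trace, Matrix.diag_apply, Matrix.inv_def, Matrix.smul_apply,
      Ring.inverse_eq_inv', smul_eq_mul]
    exact Finset.measurable_sum _ fun i _ => hdet.inv.mul (hadj i)
  have hgain : Measurable fun ω => zfGain (H ω) :=
    ((htr.const_div 1).sqrt).pow_const 2
  have hset : MeasurableSet {ω | IsUnit ((H ω)ᴴ * H ω).det} := by
    simp only [isUnit_iff_ne_zero]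
    exact (measurableSet_eq_fun hdet measurable_const).compl
  unfold zfSumRate
  simp only [sinr_zfPrecoder]
  refine Finset.measurable_sum _ fun k _ => ?_
  have : Measurable fun ω =>
      if IsUnit ((H ω)ᴴ * H ω).det then P * zfGain (H ω) / σ2 else 0 :=
    Measurable.ite hset ((hgain.const_mul P).div_const σ2) measurable_const
  exact (Real.measurable_log.comp (this.const_add 1)).div_const _

end ZeroForcing

/-! ### The planar array and the trivial rate bound. -/

section Channel

lemma channelMatrix_apply {N : ℕ} (hN : 1 ≤ N) (H : ℝ) {K : ℕ} (pos : Fin K → ℝ × ℝ)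
    (i : Fin N × Fin N) (k : Fin K) :
    channelMatrix N N H pos i k =
      Complex.exp (Complex.I * ((2 * Real.pi * (i.1 : ℝ) * ((pos k).2 / (2 * H)) : ℝ) : ℂ)) *
      Complex.exp (Complex.I * ((2 * Real.pi * (i.2 : ℝ) * ((pos k).1 / (2 * H)) : ℝ) : ℂ)) := by
  have hN0 : (0 : ℝ) < N := by exact_mod_cast hN
  have h1 : (((√((N : ℝ) * N) : ℝ) : ℂ)) * (((1 / √(N : ℝ) : ℝ) : ℂ) * ((1 / √(N : ℝ) : ℝ) : ℂ))
      = 1 := by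
    rw [← Complex.ofReal_mul, ← Complex.ofReal_mul, Real.sqrt_mul_self hN0.le, div_mul_div_comm,
      Real.mul_self_sqrt hN0.le, one_mul, mul_one_div_cancel hN0.ne', Complex.ofReal_one]
  simp only [channelMatrix, steeringVector, responseVector, Matrix.of_apply]
  rw [mul_mul_mul_comm, ← mul_assoc, h1, one_mul]

lemma norm_exp_I_mul_ofReal (t : ℝ) : ‖Complex.exp (Complex.I * (t : ℂ))‖ = 1 := by
  rw [mul_comm]; exact Complex.norm_exp_ofReal_mul_I t

lemma norm_channelMatrix_apply {N : ℕ} (hN : 1 ≤ N) (H : ℝ) {K : ℕ} (pos : Fin K → ℝ × ℝ)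
    (i : Fin N × Fin N) (k : Fin K) : ‖channelMatrix N N H pos i k‖ = 1 := by
  rw [channelMatrix_apply hN, norm_mul, norm_exp_I_mul_ofReal, norm_exp_I_mul_ofReal, one_mul]

lemma measurable_upaSumRate (N : ℕ) (P σ2 H : ℝ) (K : ℕ) :
    Measurable fun pos : Fin K → ℝ × ℝ => upaSumRate N N P σ2 H pos := by
  refine measurable_zfSumRate P σ2 fun i k => ?_
  have : Continuous fun pos : Fin K → ℝ × ℝ => channelMatrix N N H pos i k := by
    simp only [channelMatrix, steeringVector, responseVector, Matrix.of_apply]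
    fun_prop
  exact this.measurable

lemma upaSumRate_le {N : ℕ} (hN : 1 ≤ N) {P σ2 : ℝ} (hP : 0 ≤ P) (hσ2 : 0 < σ2) (H : ℝ) {K : ℕ}
    (pos : Fin K → ℝ × ℝ) :
    upaSumRate N N P σ2 H pos ≤ K * Real.logb 2 (1 + P * (N : ℝ) ^ 2 / σ2) := by
  rcases Nat.eq_zero_or_pos K with rfl | hK
  · simp [upaSumRate, zfSumRate]
  refine zfSumRate_le_of_gain_le hP hσ2 (by positivity) fun hu => ?_
  -- At a basis vector the Rayleigh quotient is a squared column norm: `N ^ 2` entries of modulus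
  -- one.
  have h := zfGain_mul_sum_le hu (Pi.single ⟨0, hK⟩ 1)
  have h1 : ∑ k, ‖(Pi.single (⟨0, hK⟩ : Fin K) (1 : ℂ) : Fin K → ℂ) k‖ ^ 2 = 1 := by
    rw [Finset.sum_eq_single (⟨0, hK⟩ : Fin K)] <;> simp +contextual
  rw [h1, mul_one] at h
  refine h.trans_eq ?_
  simp [norm_channelMatrix_apply hN, sq]

end Channel

/-! ### Averaging over the user locations. -/

section UserLaw

lemma isProbabilityMeasure_userLaw {R : ℝ} (hR : 0 < R) (K : ℕ) :
    IsProbabilityMeasure (userLaw R K) := by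
  have hvol : (volume : Measure (ℝ × ℝ)) (Set.Icc (-R) R ×ˢ Set.Icc (-R) R) =
      ENNReal.ofReal (R + R) * ENNReal.ofReal (R + R) := by
    rw [Measure.volume_eq_prod, Measure.prod_prod, Real.volume_Icc, sub_neg_eq_add]
  have : IsProbabilityMeasure
      (cond (volume : Measure (ℝ × ℝ)) (Set.Icc (-R) R ×ˢ Set.Icc (-R) R)) := by
    refine cond_isProbabilityMeasure_of_finite ?_ ?_
    · rw [hvol]
      exact mul_ne_zero (by simpa using hR) (by simpa using hR)
    · rw [hvol]
      exact ENNReal.mul_ne_top ENNReal.ofReal_ne_top ENNReal.ofReal_ne_top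
  unfold userLaw
  infer_instance

/-- Besides total mass one, this is all that is needed of the uniform law. -/
lemma ae_userLaw_mem (R : ℝ) (K : ℕ) :
    ∀ᵐ pos ∂userLaw R K, ∀ k, |(pos k).1| ≤ R ∧ |(pos k).2| ≤ R := by
  have hms : MeasurableSet (Set.Icc (-R) R ×ˢ Set.Icc (-R) R) :=
    measurableSet_Icc.prod measurableSet_Icc
  rw [ae_all_iff]
  intro k
  have h := (Measure.tendsto_eval_ae_ae
    (μ := fun _ : Fin K => cond (volume : Measure (ℝ × ℝ)) (Set.Icc (-R) R ×ˢ Set.Icc (-R) R))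
    (i := k)).eventually (ae_cond_mem hms)
  filter_upwards [h] with pos hpos
  exact ⟨abs_le.2 hpos.1, abs_le.2 hpos.2⟩

lemma integrable_upaSumRate {N : ℕ} (hN : 1 ≤ N) {P σ2 : ℝ} (hP : 0 ≤ P) (hσ2 : 0 < σ2) (H : ℝ)
    {R : ℝ} (hR : 0 < R) (K : ℕ) :
    Integrable (fun pos => upaSumRate N N P σ2 H pos) (userLaw R K) := by
  have := isProbabilityMeasure_userLaw hR K
  refine Integrable.of_bound (measurable_upaSumRate N P σ2 H K).aestronglyMeasurable
    (K * Real.logb 2 (1 + P * (N : ℝ) ^ 2 / σ2)) (Eventually.of_forall fun pos => ?_)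
  rw [Real.norm_of_nonneg (show 0 ≤ upaSumRate N N P σ2 H pos from zfSumRate_nonneg hP hσ2.le _)]
  exact upaSumRate_le hN hP hσ2 H pos

lemma integral_upaSumRate_nonneg (N : ℕ) {P σ2 : ℝ} (hP : 0 ≤ P) (hσ2 : 0 ≤ σ2) (H R : ℝ)
    (K : ℕ) : 0 ≤ ∫ pos, upaSumRate N N P σ2 H pos ∂userLaw R K :=
  integral_nonneg fun _ => zfSumRate_nonneg hP hσ2 _

lemma integral_upaSumRate_le_of_ae {N : ℕ} (hN : 1 ≤ N) {P σ2 : ℝ} (hP : 0 ≤ P) (hσ2 : 0 < σ2)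
    (H : ℝ) {R : ℝ} (hR : 0 < R) (K : ℕ) {B : ℝ}
    (hB : ∀ᵐ pos ∂userLaw R K, upaSumRate N N P σ2 H pos ≤ B) :
    ∫ pos, upaSumRate N N P σ2 H pos ∂userLaw R K ≤ B := by
  have := isProbabilityMeasure_userLaw hR K
  refine (integral_mono_ae (integrable_upaSumRate hN hP hσ2 H hR K)
    (integrable_const B) hB).trans_eq ?_
  simp

end UserLaw

/-! ### Numerical rank of the channel and the exponentially small gain. -/

section LowRank

/-- More points than monomials of bidegree below `L` admit a nontrivial annihilating weight. -/
lemma exists_weight_annihilating_monomials {K L : ℕ} (hKL : L ^ 2 < K) (z w : Fin K → ℂ) :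
    ∃ c : Fin K → ℂ, c ≠ 0 ∧ ∀ a < L, ∀ b < L, ∑ k, c k * (z k ^ a * w k ^ b) = 0 := by
  let A : Matrix (Fin L × Fin L) (Fin K) ℂ :=
    Matrix.of fun ab k => z k ^ (ab.1 : ℕ) * w k ^ (ab.2 : ℕ)
  have hker : LinearMap.ker A.mulVecLin ≠ ⊥ := by
    apply LinearMap.ker_ne_bot_of_finrank_lt
    simpa [sq] using hKL
  obtain ⟨c, hc, hc0⟩ := (Submodule.ne_bot_iff _).1 hker
  refine ⟨c, hc0, fun a ha b hb => ?_⟩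
  have h := congrFun (LinearMap.mem_ker.1 hc) (⟨a, ha⟩, ⟨b, hb⟩)
  simp only [Matrix.mulVecLin_apply, Matrix.mulVec, dotProduct, Matrix.of_apply, A,
    Pi.zero_apply] at h
  rw [← h]
  exact Finset.sum_congr rfl fun k _ => mul_comm _ _

/-- The tail is at most twice its first term, as `T ≤ L / 2`. One term of the series of `exp (e² T)`
gives `(e² T) ^ L / L! ≤ exp L`, that is `T ^ L / L! ≤ exp (-L)`. -/
lemma norm_exp_sub_taylor_le {L : ℕ} {T : ℝ} (hT : 0 ≤ T) (hTL : Real.exp 2 * T ≤ L) {x : ℂ}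
    (hx : ‖x‖ ≤ T) :
    ‖Complex.exp x - ∑ a ∈ Finset.range L, x ^ a / (a.factorial : ℂ)‖ ≤ 2 * Real.exp (-L) := by
  have he : 2 ≤ Real.exp 2 := by linarith [Real.add_one_le_exp (2 : ℝ)]
  have h2T : 2 * T ≤ L := (mul_le_mul_of_nonneg_right he hT).trans hTL
  have hfrac : ‖x‖ / (L.succ : ℝ) ≤ 1 / 2 := by
    rw [div_le_iff₀ (by positivity)]
    push_cast
    linarith
  have hpow : T ^ L / (L.factorial : ℝ) ≤ Real.exp (-L) := by
    have h := Real.pow_div_factorial_le_exp (x := Real.exp 2 * T) (by positivity) L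
    rw [mul_pow, ← Real.exp_nat_mul, mul_div_assoc] at h
    have h' : Real.exp (L * 2) * (T ^ L / (L.factorial : ℝ)) ≤ Real.exp (L * 2) * Real.exp (-L) := by
      rw [← Real.exp_add]
      exact h.trans (Real.exp_le_exp.2 (by linarith))
    exact le_of_mul_le_mul_left h' (Real.exp_pos _)
  calc _ ≤ ‖x‖ ^ L / (L.factorial : ℝ) * 2 := Complex.exp_bound' hfrac
    _ ≤ T ^ L / (L.factorial : ℝ) * 2 := by gcongr
    _ ≤ _ := by linarith

lemma norm_sum_mul_exp_mul_exp_le {K L : ℕ} {T : ℝ} (hT : 0 ≤ T) (hTL : Real.exp 2 * T ≤ L)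
    {z w c : Fin K → ℂ} {s t : ℂ}
    (hc : ∀ a < L, ∀ b < L, ∑ k, c k * (z k ^ a * w k ^ b) = 0)
    (hz : ∀ k, ‖s * z k‖ ≤ T) (hw : ∀ k, ‖t * w k‖ ≤ T)
    (hez : ∀ k, ‖Complex.exp (s * z k)‖ = 1) (hew : ∀ k, ‖Complex.exp (t * w k)‖ = 1) :
    ‖∑ k, c k * (Complex.exp (s * z k) * Complex.exp (t * w k))‖ ≤
      8 * Real.exp (-L) * ∑ k, ‖c k‖ := by
  let p : ℂ → ℂ := fun x => ∑ a ∈ Finset.range L, x ^ a / (a.factorial : ℂ)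
  have hp0 : ∑ k, c k * (p (s * z k) * p (t * w k)) = 0 := by
    have : ∀ k, c k * (p (s * z k) * p (t * w k)) =
        ∑ a ∈ Finset.range L, ∑ b ∈ Finset.range L,
          (s ^ a / (a.factorial : ℂ) * (t ^ b / (b.factorial : ℂ))) *
            (c k * (z k ^ a * w k ^ b)) := by
      intro k
      simp only [p]
      rw [Finset.sum_mul_sum, Finset.mul_sum]
      refine Finset.sum_congr rfl fun a _ => ?_
      rw [Finset.mul_sum]
      refine Finset.sum_congr rfl fun b _ => ?_
      ring
    simp only [this]
    rw [Finset.sum_comm]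
    refine Finset.sum_eq_zero fun a ha => ?_
    rw [Finset.sum_comm]
    refine Finset.sum_eq_zero fun b hb => ?_
    rw [← Finset.mul_sum, hc a (Finset.mem_range.1 ha) b (Finset.mem_range.1 hb), mul_zero]
  set δ := 2 * Real.exp (-(L : ℝ)) with hδ
  have hδ0 : 0 ≤ δ := by positivity
  have hδ2 : δ ≤ 2 := by
    have : Real.exp (-(L : ℝ)) ≤ 1 := Real.exp_le_one_iff.2 (by simp)
    linarith
  have hterm : ∀ k, ‖Complex.exp (s * z k) * Complex.exp (t * w k) -
      p (s * z k) * p (t * w k)‖ ≤ 4 * δ := by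
    intro k
    have h1 := norm_exp_sub_taylor_le hT hTL (hz k)
    have h2 := norm_exp_sub_taylor_le hT hTL (hw k)
    set E := Complex.exp (s * z k)
    set F := Complex.exp (t * w k)
    have hF := hew k
    have hE := hez k
    -- Only unimodular factors and truncation errors occur here, so the Taylor polynomials need no
    -- bound of their own.
    have hdec : E * F - p (s * z k) * p (t * w k) =
        (E - p (s * z k)) * F + E * (F - p (t * w k)) -
          (E - p (s * z k)) * (F - p (t * w k)) := by ring
    rw [hdec]
    calc _ ≤ ‖E - p (s * z k)‖ * ‖F‖ + ‖E‖ * ‖F - p (t * w k)‖ +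
          ‖E - p (s * z k)‖ * ‖F - p (t * w k)‖ := by
          refine (norm_sub_le _ _).trans ?_
          rw [norm_mul (E - _)]
          gcongr
          refine (norm_add_le _ _).trans_eq ?_
          rw [norm_mul, norm_mul]
      _ ≤ δ * 1 + 1 * δ + δ * δ := by
          rw [hF, hE]
          gcongr
      _ ≤ 4 * δ := by nlinarith
  calc _ = ‖∑ k, c k * (Complex.exp (s * z k) * Complex.exp (t * w k) -
          p (s * z k) * p (t * w k))‖ := by
        simp only [mul_sub, Finset.sum_sub_distrib, hp0, sub_zero]
    _ ≤ ∑ k, ‖c k‖ * (4 * δ) := by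
        refine (norm_sum_le _ _).trans (Finset.sum_le_sum fun k _ => ?_)
        rw [norm_mul]
        exact mul_le_mul_of_nonneg_left (hterm k) (norm_nonneg _)
    _ = _ := by rw [← Finset.sum_mul, hδ]; ring

lemma zfGain_channelMatrix_le {N K L : ℕ} (hN : 1 ≤ N) (hKL : L ^ 2 < K) {H R : ℝ} (hH : 0 < H)
    (hTL : Real.exp 2 * (Real.pi * N * (R / H)) ≤ L) {pos : Fin K → ℝ × ℝ}
    (hpos : ∀ k, |(pos k).1| ≤ R ∧ |(pos k).2| ≤ R)
    (hu : IsUnit ((channelMatrix N N H pos)ᴴ * channelMatrix N N H pos).det) :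
    zfGain (channelMatrix N N H pos) ≤ 64 * (N : ℝ) ^ 2 * K * Real.exp (-(2 * L)) := by
  obtain ⟨c, hc0, hc⟩ := exists_weight_annihilating_monomials hKL
    (fun k => ((pos k).2 : ℂ)) (fun k => ((pos k).1 : ℂ))
  have hR : 0 ≤ R := (abs_nonneg _).trans (hpos ⟨0, (Nat.zero_le _).trans_lt hKL⟩).1
  have hSpos : 0 < ∑ k, ‖c k‖ ^ 2 := by
    obtain ⟨k, hk⟩ := Function.ne_iff.1 hc0
    exact Finset.sum_pos' (fun _ _ => sq_nonneg _)
      ⟨k, Finset.mem_univ _, pow_pos (norm_pos_iff.2 hk) 2⟩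
  have hent : ∀ i, ‖(channelMatrix N N H pos *ᵥ c) i‖ ≤ 8 * Real.exp (-L) * ∑ k, ‖c k‖ := by
    intro i
    let f : Fin N → ℂ := fun m => Complex.I * ((2 * Real.pi * (m : ℝ) * (1 / (2 * H)) : ℝ) : ℂ)
    have hf : ∀ (m : Fin N) (x : ℝ), f m * (x : ℂ) =
        Complex.I * ((2 * Real.pi * (m : ℝ) * (x / (2 * H)) : ℝ) : ℂ) := by
      intro m x
      simp only [f]
      push_cast
      ring
    have hfn : ∀ (m : Fin N) (x : ℝ), |x| ≤ R → ‖f m * (x : ℂ)‖ ≤ Real.pi * N * (R / H) := by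
      intro m x hx
      have hm : (m : ℝ) ≤ N := by exact_mod_cast m.2.le
      rw [hf, norm_mul, Complex.norm_I, one_mul, Complex.norm_real, Real.norm_eq_abs, abs_mul,
        abs_div, abs_of_pos (by positivity : 0 < 2 * H),
        abs_of_nonneg (by positivity : 0 ≤ 2 * Real.pi * (m : ℝ))]
      calc 2 * Real.pi * (m : ℝ) * (|x| / (2 * H)) ≤ 2 * Real.pi * N * (R / (2 * H)) := by gcongr
        _ = _ := by field_simp
    have hfe : ∀ (m : Fin N) (x : ℝ), ‖Complex.exp (f m * (x : ℂ))‖ = 1 := fun m x => by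
      rw [hf, norm_exp_I_mul_ofReal]
    have h := norm_sum_mul_exp_mul_exp_le (T := Real.pi * N * (R / H)) (by positivity) hTL hc
      (fun k => hfn i.1 _ (hpos k).2) (fun k => hfn i.2 _ (hpos k).1)
      (fun k => hfe i.1 _) (fun k => hfe i.2 _)
    refine Eq.trans_le ?_ h
    congr 1
    simp only [Matrix.mulVec, dotProduct, channelMatrix_apply hN, hf]
    exact Finset.sum_congr rfl fun k _ => mul_comm _ _
  -- Passing from the `ℓ¹` to the `ℓ²` norm of `c` costs the factor `K` in the gain.
  have hsq : (∑ k, ‖c k‖) ^ 2 ≤ K * ∑ k, ‖c k‖ ^ 2 := by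
    simpa using sq_sum_le_card_mul_sum_sq (s := Finset.univ) (f := fun k => ‖c k‖)
  refine le_of_mul_le_mul_right ?_ hSpos
  calc _ ≤ ∑ i, ‖(channelMatrix N N H pos *ᵥ c) i‖ ^ 2 := zfGain_mul_sum_le hu c
    _ ≤ ∑ _i : Fin N × Fin N, (8 * Real.exp (-L) * ∑ k, ‖c k‖) ^ 2 := by
        gcongr with i
        exact hent i
    _ = 64 * (N : ℝ) ^ 2 * Real.exp (-(2 * L)) * (∑ k, ‖c k‖) ^ 2 := by
        have : Real.exp (-(2 * (L : ℝ))) = Real.exp (-L) ^ 2 := by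
          rw [← Real.exp_nat_mul]; congr 1; push_cast; ring
        rw [this]
        simp
        ring
    _ ≤ 64 * (N : ℝ) ^ 2 * Real.exp (-(2 * L)) * (K * ∑ k, ‖c k‖ ^ 2) := by gcongr
    _ = _ := by ring

lemma upaSumRate_le_exp {N K L : ℕ} (hN : 1 ≤ N) (hKL : L ^ 2 < K) {P σ2 H R : ℝ} (hP : 0 ≤ P)
    (hσ2 : 0 < σ2) (hH : 0 < H) (hTL : Real.exp 2 * (Real.pi * N * (R / H)) ≤ L)
    {pos : Fin K → ℝ × ℝ} (hpos : ∀ k, |(pos k).1| ≤ R ∧ |(pos k).2| ≤ R) :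
    upaSumRate N N P σ2 H pos ≤
      64 * P / (σ2 * Real.log 2) * ((N : ℝ) ^ 2 * (K : ℝ) ^ 2 * Real.exp (-(2 * L))) := by
  have hlog : 0 < Real.log 2 := Real.log_pos one_lt_two
  set B := 64 * (N : ℝ) ^ 2 * K * Real.exp (-(2 * L)) with hB
  have hB0 : 0 ≤ B := by positivity
  have h := zfSumRate_le_of_gain_le hP hσ2 hB0
    (fun hu => zfGain_channelMatrix_le hN hKL hH hTL hpos hu)
  -- `log (1 + x) ≤ x` carries the exponential smallness of the gain over to the rate.
  have hl : Real.logb 2 (1 + P * B / σ2) ≤ P * B / σ2 / Real.log 2 := by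
    unfold Real.logb
    gcongr
    have := Real.log_le_sub_one_of_pos (show 0 < 1 + P * B / σ2 by positivity)
    linarith
  calc _ ≤ (K : ℝ) * Real.logb 2 (1 + P * B / σ2) := h
    _ ≤ K * (P * B / σ2 / Real.log 2) := by gcongr
    _ = _ := by rw [hB]; field_simp

end LowRank

end SatelliteUPA

namespace SatelliteUPA

/-! ### Growth comparisons. -/

section Asymptotics

lemma tendsto_natCast_rpow_atTop {q : ℝ} (hq : 0 < q) :
    Tendsto (fun N : ℕ => (N : ℝ) ^ q) atTop atTop :=
  (tendsto_rpow_atTop hq).comp tendsto_natCast_atTop_atTop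

lemma natCast_le_two_mul_sq_rpow {p : ℝ} (hp0 : 0 ≤ p) {N K : ℕ} (hN : 1 ≤ N)
    (hK : |(K : ℝ) - ((N : ℝ) ^ 2) ^ p| < 1) : (K : ℝ) ≤ 2 * ((N : ℝ) ^ 2) ^ p := by
  have hN1 : (1 : ℝ) ≤ (N : ℝ) ^ 2 := one_le_pow₀ (by exact_mod_cast hN)
  have := Real.one_le_rpow hN1 hp0
  linarith [(abs_lt.1 hK).2]

lemma eventually_logb_one_add_mul_sq_le {A : ℝ} (hA : 0 ≤ A) :
    ∀ᶠ N : ℕ in atTop, Real.logb 2 (1 + A * (N : ℝ) ^ 2) ≤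
      (Real.log (1 + A) + 1) / Real.log 2 * Real.log ((N : ℝ) ^ 2) := by
  have hlog : Tendsto (fun N : ℕ => Real.log ((N : ℝ) ^ 2)) atTop atTop :=
    Real.tendsto_log_atTop.comp
      ((tendsto_pow_atTop two_ne_zero).comp tendsto_natCast_atTop_atTop)
  filter_upwards [hlog.eventually_ge_atTop 1, eventually_ge_atTop 1] with N hN hN1
  have hN2 : (1 : ℝ) ≤ (N : ℝ) ^ 2 := one_le_pow₀ (by exact_mod_cast hN1)
  have hlA : 0 ≤ Real.log (1 + A) := Real.log_nonneg (by linarith)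
  have hl2 : 0 < Real.log 2 := Real.log_pos one_lt_two
  have h : Real.log (1 + A * (N : ℝ) ^ 2) ≤ Real.log (1 + A) + Real.log ((N : ℝ) ^ 2) := by
    rw [← Real.log_mul (by positivity) (by positivity)]
    exact Real.log_le_log (by positivity) (by linarith)
  rw [Real.logb, div_mul_eq_mul_div]
  gcongr
  nlinarith

/-- The `+ 1` absorbs the losses from the floor in `L` and from the rounding of `K`. -/
lemma eventually_mul_rpow_add_one_le {a b : ℝ} (ha : 0 ≤ a) (hab : a < b) {C : ℝ} :
    ∀ᶠ N : ℕ in atTop, C * (N : ℝ) ^ a + 1 ≤ (N : ℝ) ^ b := by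
  filter_upwards [(tendsto_natCast_rpow_atTop (sub_pos.2 hab)).eventually_ge_atTop (C + 1),
    eventually_ge_atTop 1] with N hN hN1
  have hN0 : (1 : ℝ) ≤ N := by exact_mod_cast hN1
  have h1 : 1 ≤ (N : ℝ) ^ a := Real.one_le_rpow hN0 ha
  have h2 : (N : ℝ) ^ b = (N : ℝ) ^ a * (N : ℝ) ^ (b - a) := by
    rw [← Real.rpow_add (by linarith)]
    congr 1
    ring
  rw [h2]
  nlinarith

lemma tendsto_pow_mul_exp_neg_rpow (n : ℕ) {q b : ℝ} (hq : 0 < q) (hb : 0 < b) :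
    Tendsto (fun N : ℕ => (N : ℝ) ^ n * Real.exp (-b * (N : ℝ) ^ q)) atTop (𝓝 0) := by
  refine ((tendsto_rpow_mul_exp_neg_mul_atTop_nhds_zero (n / q) b hb).comp
    (tendsto_natCast_rpow_atTop hq)).congr fun N => ?_
  simp only [Function.comp_apply]
  rw [← Real.rpow_mul (Nat.cast_nonneg N), mul_div_cancel₀ _ hq.ne', Real.rpow_natCast]

lemma sq_rpow_natCast (N : ℕ) (s : ℝ) : ((N : ℝ) ^ 2) ^ s = (N : ℝ) ^ (2 * s) := by
  rw [Real.rpow_mul (Nat.cast_nonneg N), Real.rpow_two]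

end Asymptotics

end SatelliteUPA

open SatelliteUPA in
/-- The array is `N × N`, so `M = N ^ 2`, and `M → ∞` means `N → ∞`; the number of users is `M ^ p`
rounded to an integer in any way. -/
theorem theorem3 (p r P σ2 : ℝ) (hp0 : 0 ≤ p) (hp1 : p ≤ 1) (hr0 : 0 ≤ r) (hr1 : r < 1 / 2)
    (hP : 0 < P) (hσ2 : 0 < σ2) (K : ℕ → ℕ) (R H : ℕ → ℝ)
    (hK : ∀ N : ℕ, 1 ≤ N → |(K N : ℝ) - ((N : ℝ) ^ 2) ^ p| < 1)
    (hH : ∀ N : ℕ, 1 ≤ N → 0 < H N)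
    (hR : ∀ N : ℕ, 1 ≤ N → R N / H N = ((N : ℝ) ^ 2) ^ (-r)) :
    (∀ N : ℕ, 1 ≤ N →
      Integrable (fun pos => SatelliteUPA.upaSumRate N N P σ2 (H N) pos)
        (SatelliteUPA.userLaw (R N) (K N))) ∧
    (p + 2 * r - 1 ≤ 0 →
      (fun N : ℕ => ∫ pos, SatelliteUPA.upaSumRate N N P σ2 (H N) pos
          ∂(SatelliteUPA.userLaw (R N) (K N)))
        =O[atTop] fun N : ℕ => ((N : ℝ) ^ 2) ^ p * Real.log ((N : ℝ) ^ 2)) ∧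
    (0 < p + 2 * r - 1 →
      Tendsto (fun N : ℕ => ∫ pos, SatelliteUPA.upaSumRate N N P σ2 (H N) pos
          ∂(SatelliteUPA.userLaw (R N) (K N)))
        atTop (𝓝 0)) := by
  have hRpos : ∀ N : ℕ, 1 ≤ N → 0 < R N := by
    intro N hN
    have hN0 : (0 : ℝ) < N := by exact_mod_cast hN
    have h : 0 < R N / H N := by rw [hR N hN]; positivity
    exact (div_pos_iff_of_pos_right (hH N hN)).1 h
  refine ⟨fun N hN => integrable_upaSumRate hN hP.le hσ2 _ (hRpos N hN) _, fun _ => ?_,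
    fun hpr => ?_⟩
  · have hA : 0 ≤ P / σ2 := by positivity
    refine IsBigO.of_bound (2 * ((Real.log (1 + P / σ2) + 1) / Real.log 2)) ?_
    filter_upwards [eventually_logb_one_add_mul_sq_le hA, eventually_ge_atTop 1] with N hlog hN
    have hN2 : (1 : ℝ) ≤ (N : ℝ) ^ 2 := one_le_pow₀ (by exact_mod_cast hN)
    have hlogN := Real.log_nonneg hN2
    have hle := integral_upaSumRate_le_of_ae hN hP.le hσ2 (H N) (hRpos N hN) (K N)
      (Eventually.of_forall fun pos => upaSumRate_le hN hP.le hσ2 (H N) pos)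
    rw [Real.norm_of_nonneg (integral_upaSumRate_nonneg N hP.le hσ2.le _ _ _),
      Real.norm_of_nonneg (by positivity)]
    rw [mul_div_right_comm] at hle
    have h0 : 0 ≤ Real.logb 2 (1 + P / σ2 * (N : ℝ) ^ 2) :=
      Real.logb_nonneg one_lt_two (le_add_of_nonneg_right (by positivity))
    calc _ ≤ (K N : ℝ) * Real.logb 2 (1 + P / σ2 * (N : ℝ) ^ 2) := hle
      _ ≤ (2 * ((N : ℝ) ^ 2) ^ p) *
          ((Real.log (1 + P / σ2) + 1) / Real.log 2 * Real.log ((N : ℝ) ^ 2)) :=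
          mul_le_mul (natCast_le_two_mul_sq_rpow hp0 hN (hK N hN)) hlog h0 (by positivity)
      _ = _ := by ring
  -- `q > 1 - 2 r` makes `L` dominate the phases; `q < p` keeps `L ^ 2` below `K`.
  · obtain ⟨q, hq1, hq2⟩ := exists_between (show 1 - 2 * r < p by linarith)
    have hq0 : 0 < q := by linarith
    set C := 64 * P / (σ2 * Real.log 2) with hC
    have hlog2 : 0 < Real.log 2 := Real.log_pos one_lt_two
    have hC0 : 0 ≤ C := by positivity
    -- `4 N ^ 6` is `N²` times the square of `K ≤ 2 N²`; `exp 2` pays for `L > N ^ q - 1`.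
    have hlim : Tendsto (fun N : ℕ => C * 4 * Real.exp 2 *
        ((N : ℝ) ^ 6 * Real.exp (-2 * (N : ℝ) ^ q))) atTop (𝓝 0) := by
      simpa using (tendsto_pow_mul_exp_neg_rpow 6 hq0 two_pos).const_mul (C * 4 * Real.exp 2)
    refine squeeze_zero'
      (Eventually.of_forall fun N => integral_upaSumRate_nonneg N hP.le hσ2.le _ _ _) ?_ hlim
    filter_upwards [eventually_ge_atTop 1,
      eventually_mul_rpow_add_one_le (show 0 ≤ 1 - 2 * r by linarith) hq1
        (C := Real.exp 2 * Real.pi),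
      eventually_mul_rpow_add_one_le (show 0 ≤ 2 * q by linarith)
        (show 2 * q < 2 * p by linarith) (C := 1)] with N hN hTq hqp
    have hN1 : (1 : ℝ) ≤ N := by exact_mod_cast hN
    have hN0 : (0 : ℝ) < N := by linarith
    have hLlt := Nat.lt_floor_add_one ((N : ℝ) ^ q)
    have hLle := Nat.floor_le (show 0 ≤ (N : ℝ) ^ q by positivity)
    set L := ⌊(N : ℝ) ^ q⌋₊
    have hKL : L ^ 2 < K N := by
      have h1 : (L : ℝ) ^ 2 ≤ (N : ℝ) ^ (2 * q) := by
        calc (L : ℝ) ^ 2 ≤ ((N : ℝ) ^ q) ^ 2 := by gcongr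
          _ = _ := by rw [mul_comm 2 q, Real.rpow_mul hN0.le, Real.rpow_two]
      have h2 := (abs_lt.1 (hK N hN)).1
      rw [sq_rpow_natCast] at h2
      have : (L : ℝ) ^ 2 < K N := by linarith
      exact_mod_cast this
    have hTL : Real.exp 2 * (Real.pi * N * (R N / H N)) ≤ L := by
      have h : Real.exp 2 * (Real.pi * N * (R N / H N)) =
          Real.exp 2 * Real.pi * (N : ℝ) ^ (1 - 2 * r) := by
        rw [hR N hN, sq_rpow_natCast, sub_eq_add_neg, Real.rpow_add hN0, Real.rpow_one,
          mul_neg]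
        ring
      rw [h]
      linarith
    have hKN : (K N : ℝ) ≤ 2 * (N : ℝ) ^ 2 := by
      have h := natCast_le_two_mul_sq_rpow hp0 hN (hK N hN)
      have h' := Real.rpow_le_rpow_of_exponent_le (one_le_pow₀ hN1 : (1 : ℝ) ≤ (N : ℝ) ^ 2) hp1
      rw [Real.rpow_one] at h'
      linarith
    refine integral_upaSumRate_le_of_ae hN hP.le hσ2 (H N) (hRpos N hN) (K N) ?_
    filter_upwards [ae_userLaw_mem (R N) (K N)] with pos hpos
    calc _ ≤ C * ((N : ℝ) ^ 2 * (K N : ℝ) ^ 2 * Real.exp (-(2 * L))) :=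
          upaSumRate_le_exp hN hKL hP.le hσ2 (hH N hN) hTL hpos
      _ ≤ C * ((N : ℝ) ^ 2 * (2 * (N : ℝ) ^ 2) ^ 2 * Real.exp (2 + -2 * (N : ℝ) ^ q)) := by
          gcongr
          linarith
      _ = _ := by rw [Real.exp_add]; ring
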